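/- Let $\Omega\subset\mathbb{R}^d$ be a bounded open set and let $f:\Omega\to\mathbb{R}$ be a measurable function such that, for some constants $c,C$, $0<c<f(x)<C<+\infty$ for a.e. $x\in\Omega$. Let $\mu=f\,dx$ on $\Omega$, and let $\nu$ be a Borel probability measure on $\mathbb{R}^d$. Here $H^1(\Omega;\mathbb{R}^d)$ is the space of maps $T\in L^2(\Omega;\mathbb{R}^d)$ having a weak Jacobian matrix $\nabla T\in L^2(\Omega;\mathbb{R}^{d\times d})$, $|\nabla T|$ is the Euclidean (Frobenius) norm of $\nabla T$, and $T_\#\mu$ is the image measure of $\mu$ by $T$. Assume that there exists at least one $T\in H^1(\Omega;\mathbb{R}^d)$ with $T_\#\mu=\nu$. Then the problem $$\inf\left\{\int_\Omega\left(|T(x)-x|^2+|\nabla T(x)|^2\right)f(x)\,dx \;:\; T\in H^1(\Omega;\mathbb{R}^d),\ T_\#\mu=\nu\right\}$$ admits at least one solution, i.e. there is an admissible $T$ at which the infimum is attained. -/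

import Mathlib

open MeasureTheory Set
open scoped ENNReal ContDiff

noncomputable section

/-- `v` is the weak partial derivative `∂u/∂xⱼ` on the open set `Ω`: both functions are locally
integrable on `Ω` and `∫_Ω u ∂ⱼφ = - ∫_Ω v φ` for every `φ ∈ C_c^∞(Ω)`. -/
def IsWeakPartialDeriv {d : ℕ} (Ω : Set (EuclideanSpace ℝ (Fin d))) (j : Fin d)
    (u v : EuclideanSpace ℝ (Fin d) → ℝ) : Prop :=
  LocallyIntegrableOn u Ω ∧ LocallyIntegrableOn v Ω ∧
    ∀ φ : EuclideanSpace ℝ (Fin d) → ℝ, ContDiff ℝ ∞ φ → HasCompactSupport φ → tsupport φ ⊆ Ω →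
      ∫ x in Ω, u x * fderiv ℝ φ x (EuclideanSpace.single j 1) = - ∫ x in Ω, v x * φ x

/-- `G` is a weak Jacobian matrix of `T` on `Ω`, i.e. `G i j = ∂Tᵢ/∂xⱼ` in the weak sense. -/
def IsWeakJacobian {d : ℕ} (Ω : Set (EuclideanSpace ℝ (Fin d)))
    (T : EuclideanSpace ℝ (Fin d) → EuclideanSpace ℝ (Fin d))
    (G : EuclideanSpace ℝ (Fin d) → Matrix (Fin d) (Fin d) ℝ) : Prop :=
  ∀ i j, IsWeakPartialDeriv Ω j (fun x => T x i) (fun x => G x i j)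

/-- Weak Jacobians on an open set are unique up to a Lebesgue-null set. -/
theorem IsWeakJacobian.ae_eq {d : ℕ} {Ω : Set (EuclideanSpace ℝ (Fin d))} (hΩ : IsOpen Ω)
    {T : EuclideanSpace ℝ (Fin d) → EuclideanSpace ℝ (Fin d)}
    {G H : EuclideanSpace ℝ (Fin d) → Matrix (Fin d) (Fin d) ℝ}
    (hG : IsWeakJacobian Ω T G) (hH : IsWeakJacobian Ω T H) :
    ∀ᵐ x ∂(volume.restrict Ω), G x = H x := by
  have key : ∀ i j, ∀ᵐ x ∂(volume.restrict Ω), G x i j = H x i j := by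
    intro i j
    obtain ⟨-, g1, g2⟩ := hG i j
    obtain ⟨-, h1, h2⟩ := hH i j
    have hz := hΩ.ae_eq_zero_of_integral_contDiff_smul_eq_zero
      (f := fun x => G x i j - H x i j) (μ := volume) (g1.sub h1) ?_
    · rw [ae_restrict_iff' hΩ.measurableSet]
      filter_upwards [hz] with x hx hxΩ
      exact sub_eq_zero.1 (hx hxΩ)
    · intro φ hφ hc hs
      have e := (g2 φ hφ hc hs).symm.trans (h2 φ hφ hc hs)
      have int : ∀ w : EuclideanSpace ℝ (Fin d) → ℝ, LocallyIntegrableOn w Ω →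
          IntegrableOn (fun x => w x * φ x) Ω := by
        intro w hw
        have hk : IntegrableOn (fun x => w x * φ x) (tsupport φ) :=
          (hw.integrableOn_compact_subset hs hc).mul_continuousOn
            hφ.continuous.continuousOn hc
        refine ((integrableOn_iff_integrable_of_support_subset ?_).1 hk).integrableOn
        intro x hx
        exact subset_tsupport _ (right_ne_zero_of_mul hx)
      have e2 : ∫ x in Ω, φ x • (G x i j - H x i j) = 0 := by
        have : (fun x => φ x • (G x i j - H x i j)) =
            fun x => G x i j * φ x - H x i j * φ x := by
          funext x; simp only [smul_eq_mul]; ring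
        rw [this, integral_sub (int _ g1) (int _ h1)]
        linarith
      rw [← e2, setIntegral_eq_integral_of_forall_compl_eq_zero]
      intro x hx
      have : φ x = 0 := by
        by_contra h
        exact hx (hs (subset_tsupport _ h))
      simp [this]
  have key' := ae_all_iff.2 fun i => ae_all_iff.2 (key i)
  filter_upwards [key'] with x hx
  ext i j
  exact hx i j

open Classical in
/-- The weak Jacobian matrix `∇T` of `T` on `Ω` (a representative of it; the zero matrix field if
`T` has no weak Jacobian on `Ω`). -/
def weakJacobian {d : ℕ} (Ω : Set (EuclideanSpace ℝ (Fin d)))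
    (T : EuclideanSpace ℝ (Fin d) → EuclideanSpace ℝ (Fin d)) :
    EuclideanSpace ℝ (Fin d) → Matrix (Fin d) (Fin d) ℝ :=
  if h : ∃ G, IsWeakJacobian Ω T G then h.choose else 0

/-- `T ∈ H¹(Ω; ℝᵈ)`: `T` is in `L²(Ω)` and has a weak Jacobian matrix with entries in `L²(Ω)`.
Only the restriction of `T` to `Ω` matters. -/
def MemSobolevH1 {d : ℕ} (Ω : Set (EuclideanSpace ℝ (Fin d)))
    (T : EuclideanSpace ℝ (Fin d) → EuclideanSpace ℝ (Fin d)) : Prop :=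
  MemLp T 2 (volume.restrict Ω) ∧
    ∃ G, IsWeakJacobian Ω T G ∧ ∀ i j, MemLp (fun x => G x i j) 2 (volume.restrict Ω)

/-- The measure `f dx` on `Ω`. -/
def densityMeasure {d : ℕ} (Ω : Set (EuclideanSpace ℝ (Fin d)))
    (f : EuclideanSpace ℝ (Fin d) → ℝ) : Measure (EuclideanSpace ℝ (Fin d)) :=
  (volume.restrict Ω).withDensity fun x => ENNReal.ofReal (f x)

/-- The Sobolev transport maps from `f dx` on `Ω` to `ν`: the maps `T ∈ H¹(Ω; ℝᵈ)` whose image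
measure `T_# (f dx)` is `ν`. -/
def sobolevTransportMaps {d : ℕ} (Ω : Set (EuclideanSpace ℝ (Fin d)))
    (f : EuclideanSpace ℝ (Fin d) → ℝ) (ν : Measure (EuclideanSpace ℝ (Fin d))) :
    Set (EuclideanSpace ℝ (Fin d) → EuclideanSpace ℝ (Fin d)) :=
  {T | MemSobolevH1 Ω T ∧ AEMeasurable T (densityMeasure Ω f) ∧
    Measure.map T (densityMeasure Ω f) = ν}

/-- The functional `∫_Ω (|T(x) - x|² + |∇T(x)|²) f(x) dx` with values in `[0, ∞]`, where `|∇T|` is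
the Euclidean (Frobenius) norm of the weak Jacobian matrix. -/
def transportEnergy {d : ℕ} (Ω : Set (EuclideanSpace ℝ (Fin d)))
    (f : EuclideanSpace ℝ (Fin d) → ℝ)
    (T : EuclideanSpace ℝ (Fin d) → EuclideanSpace ℝ (Fin d)) : ℝ≥0∞ :=
  ∫⁻ x in Ω, ENNReal.ofReal
    ((‖T x - x‖ ^ 2 + ∑ i, ∑ j, (weakJacobian Ω T x i j) ^ 2) * f x)

end

/-! The proof is the direct method. Since `f` lies between `c` and `C`, the spaces `L²(f dx)` and
`L²(Ω)` coincide with equivalent norms, and the energy is the squared norm of the field `(T x - x,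
∇T x)` in the Hilbert space `L²(f dx)` (`transportEnergy_eq_eLpNorm_sq`). A minimizing sequence is
bounded there, so a subsequence converges weakly. The norm is weakly lower semicontinuous, and the
identities defining weak derivatives are linear, so the weak limit is again the field of a Sobolev
map with energy at most the infimum.

Only the constraint on the image measure is nonlinear and needs strong convergence. The boundary of
`Ω` is arbitrary, so Rellich compactness is available only locally (`tendsto_eLpNorm_cutoff`). This
suffices: `Ω` has finite measure and is filled by compact sets up to small measure, hence the maps
converge in measure, hence in distribution, and the image measure is kept.

Local Rellich is proved by Fourier analysis. After a cutoff, the derivatives bound the frequencies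
beyond `R` by `1 / R ^ 2` uniformly along the sequence; on a ball the transforms are bounded and
tend to zero pointwise. -/

/-! ### Plancherel for the Fourier integral -/

section Plancherel

open FourierTransform SchwartzMap

variable {E : Type*} [NormedAddCommGroup E] [InnerProductSpace ℝ E] [FiniteDimensional ℝ E]
  [MeasurableSpace E] [BorelSpace E]

/-- The `L²` Fourier transform agrees with the Fourier integral on `L¹ ∩ L²`. -/
theorem fourier_toLp_two_ae_eq {g : E → ℂ} (hg : Integrable g) (hg2 : MemLp g 2) :
    (𝓕 (hg2.toLp g) : Lp ℂ 2 (volume : Measure E)) =ᵐ[volume] 𝓕 g := by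
  have hcont : Continuous (𝓕 g) :=
    VectorFourier.fourierIntegral_continuous Real.continuous_fourierChar
      (by exact continuous_inner) hg
  refine ae_eq_of_integral_contDiff_smul_eq
    ((Lp.memLp (𝓕 (hg2.toLp g))).locallyIntegrable (by norm_num)) hcont.locallyIntegrable ?_
  intro φ hφ hφc
  have hs1 : HasCompactSupport (fun x => (φ x : ℂ)) :=
    hφc.comp_left (g := fun t : ℝ => (t : ℂ)) (by simp)
  have hs2 : ContDiff ℝ ∞ (fun x => (φ x : ℂ)) := Complex.ofRealCLM.contDiff.comp hφ
  set Φ : 𝓢(E, ℂ) := hs1.toSchwartzMap hs2 with hΦ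
  have h1 : ∀ x, (Φ x : ℂ) = φ x := fun x => rfl
  -- The transform of tempered distributions acts by duality, so pairing the `L²` transform with `Φ`
  -- amounts to pairing `g` with `𝓕 Φ`. The flip formula for integrable functions then moves the
  -- transform back onto `g`.
  have key := congrArg (fun D : TemperedDistribution E ℂ => D Φ)
    (Lp.fourier_toTemperedDistribution_eq (hg2.toLp g))
  simp only [TemperedDistribution.fourier_apply, Lp.toTemperedDistribution_apply] at key
  have e1 : ∫ x, φ x • (𝓕 (hg2.toLp g) : Lp ℂ 2 (volume : Measure E)) x
      = ∫ x, Φ x • (𝓕 (hg2.toLp g) : Lp ℂ 2 (volume : Measure E)) x := by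
    refine integral_congr_ae (Filter.Eventually.of_forall fun x => ?_)
    simp [h1]
  rw [e1, ← key]
  have e2 : ∫ x, (𝓕 Φ) x • (hg2.toLp g) x = ∫ x, (𝓕 Φ) x • g x := by
    refine integral_congr_ae ?_
    filter_upwards [hg2.coeFn_toLp] with x hx
    rw [hx]
  rw [e2]
  have := VectorFourier.integral_fourierIntegral_smul_eq_flip (L := innerₗ E)
    (μ := volume) (ν := volume) (f := (Φ : E → ℂ)) (g := g)
    Real.continuous_fourierChar (by exact continuous_inner) Φ.integrable hg
  rw [flip_innerₗ] at this
  exact this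

/-- Plancherel's theorem for the Fourier integral on `L¹ ∩ L²`. -/
theorem eLpNorm_fourier_eq {g : E → ℂ} (hg : Integrable g) (hg2 : MemLp g 2) :
    eLpNorm (𝓕 g) 2 volume = eLpNorm g 2 volume := by
  rw [← eLpNorm_congr_ae (fourier_toLp_two_ae_eq hg hg2), ← Lp.enorm_def, ← ofReal_norm,
    Lp.norm_fourier_eq, ofReal_norm, Lp.enorm_def, eLpNorm_congr_ae hg2.coeFn_toLp]

end Plancherel

/-! ### Weak compactness and lower semicontinuity in Hilbert space -/

section WeakCompactness

open Filter Topology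

variable {H : Type*} [NormedAddCommGroup H] [InnerProductSpace ℝ H]

/-- Bounded sequences in a separable Hilbert space have weakly convergent subsequences. -/
theorem exists_subseq_tendsto_inner [CompleteSpace H]
    [TopologicalSpace.SeparableSpace H] {x : ℕ → H} {M : ℝ}
    (hx : ∀ n, ‖x n‖ ≤ M) :
    ∃ (a : H) (φ : ℕ → ℕ), StrictMono φ ∧
      ∀ y, Tendsto (fun n => inner ℝ (x (φ n)) y) atTop (𝓝 (inner ℝ a y)) := by
  -- Sequential Banach-Alaoglu in the dual, carried to `H` by the Riesz isomorphism.
  have hc := WeakDual.isSeqCompact_closedBall ℝ H 0 M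
  obtain ⟨a, -, φ, hφ, ha⟩ := hc
    (x := fun n => StrongDual.toWeakDual (InnerProductSpace.toDual ℝ H (x n)))
    (fun n => by simpa using hx n)
  refine ⟨(InnerProductSpace.toDual ℝ H).symm (WeakDual.toStrongDual a), φ, hφ, fun y => ?_⟩
  have := ((WeakDual.eval_continuous (𝕜 := ℝ) y).tendsto a).comp ha
  simpa [Function.comp_def] using this

/-- The norm of a Hilbert space is weakly lower semicontinuous. -/
theorem norm_le_of_tendsto_inner {x : ℕ → H} {a : H} {L : ℝ}
    (h : ∀ y, Tendsto (fun n => inner ℝ (x n) y) atTop (𝓝 (inner ℝ a y)))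
    (hL : Tendsto (fun n => ‖x n‖) atTop (𝓝 L)) : ‖a‖ ≤ L := by
  have h1 : inner ℝ a a ≤ L * ‖a‖ :=
    le_of_tendsto_of_tendsto' (h a) (hL.mul_const _) fun n => real_inner_le_norm _ _
  rw [real_inner_self_eq_norm_mul_norm] at h1
  by_contra hlt
  push Not at hlt
  have : 0 ≤ L := ge_of_tendsto' hL fun n => norm_nonneg _
  nlinarith

end WeakCompactness

/-! ### Weak derivatives of cut-off functions and their Fourier transforms -/

section Rellich

open Filter Topology FourierTransform

variable {d : ℕ}

theorem eLpNorm_two_sq_eq_lintegral {α F : Type*} [MeasurableSpace α] [NormedAddCommGroup F]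
    (g : α → F) (μ : Measure α) : eLpNorm g 2 μ ^ 2 = ∫⁻ x, ‖g x‖ₑ ^ 2 ∂μ := by
  have := eLpNorm_nnreal_pow_eq_lintegral (f := g) (μ := μ) (p := 2) (by norm_num)
  simpa using this

/-- The compact support of `ψ` inside `Ω` upgrades local integrability on `Ω` to integrability on
the whole space, which the Fourier integral requires. -/
theorem MeasureTheory.LocallyIntegrableOn.integrable_mul_of_tsupport_subset {X : Type*} [TopologicalSpace X]
    [MeasurableSpace X] [OpensMeasurableSpace X] [T2Space X] {ρ : Measure X} {Ω : Set X}
    {u ψ : X → ℝ}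
    (hu : LocallyIntegrableOn u Ω ρ) (hψ : Continuous ψ) (hc : HasCompactSupport ψ)
    (hs : tsupport ψ ⊆ Ω) : Integrable (fun x => u x * ψ x) ρ := by
  have hk : IntegrableOn (fun x => u x * ψ x) (tsupport ψ) ρ :=
    (hu.integrableOn_compact_subset hs hc).mul_continuousOn hψ.continuousOn hc
  refine (integrableOn_iff_integrable_of_support_subset fun x hx => ?_).1 hk
  exact subset_tsupport _ (right_ne_zero_of_mul hx)

theorem setIntegral_mul_eq_integral_of_tsupport_subset {X : Type*} [TopologicalSpace X]
    [MeasurableSpace X] {ρ : Measure X} {Ω : Set X} (u : X → ℝ) {ψ : X → ℝ}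
    (hs : tsupport ψ ⊆ Ω) : ∫ x in Ω, u x * ψ x ∂ρ = ∫ x, u x * ψ x ∂ρ := by
  refine setIntegral_eq_integral_of_forall_compl_eq_zero fun x hx => ?_
  rw [image_eq_zero_of_notMem_tsupport (fun h => hx (hs h)), mul_zero]

/-- The `j`-th partial derivative of a function on `ℝᵈ`. -/
noncomputable abbrev partialDeriv (j : Fin d) (φ : EuclideanSpace ℝ (Fin d) → ℝ) :
    EuclideanSpace ℝ (Fin d) → ℝ :=
  fun x => fderiv ℝ φ x (EuclideanSpace.single j 1)

theorem ContDiff.partialDeriv {φ : EuclideanSpace ℝ (Fin d) → ℝ} (hφ : ContDiff ℝ ∞ φ)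
    (j : Fin d) : ContDiff ℝ ∞ (partialDeriv j φ) :=
  (hφ.fderiv_right (by simp)).clm_apply contDiff_const

theorem tsupport_partialDeriv_subset (j : Fin d) (φ : EuclideanSpace ℝ (Fin d) → ℝ) :
    tsupport (partialDeriv j φ) ⊆ tsupport φ :=
  tsupport_fderiv_apply_subset ℝ _

/-- Product rule: if `v` is the weak derivative of `u` on `Ω` and `χ` is a cutoff in `Ω`, then
`χ v + u ∂ⱼχ` is the weak derivative of `χ u` on the whole space, even against test functions
without compact support. -/
theorem IsWeakPartialDeriv.integral_cutoff {Ω : Set (EuclideanSpace ℝ (Fin d))} {j : Fin d}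
    {u v χ φ : EuclideanSpace ℝ (Fin d) → ℝ} (h : IsWeakPartialDeriv Ω j u v)
    (hχ : ContDiff ℝ ∞ χ) (hχc : HasCompactSupport χ) (hχs : tsupport χ ⊆ Ω)
    (hφ : ContDiff ℝ ∞ φ) :
    ∫ x, (u x * χ x) * partialDeriv j φ x =
      - ∫ x, (v x * χ x + u x * partialDeriv j χ x) * φ x := by
  obtain ⟨hu, hv, hw⟩ := h
  have hsub : ∀ g : EuclideanSpace ℝ (Fin d) → ℝ, tsupport (fun x => χ x * g x) ⊆ tsupport χ :=
    fun g => tsupport_mul_subset_left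
  have hsub' : ∀ g : EuclideanSpace ℝ (Fin d) → ℝ,
      tsupport (fun x => partialDeriv j χ x * g x) ⊆ tsupport χ :=
    fun g => tsupport_mul_subset_left.trans (tsupport_partialDeriv_subset j χ)
  have hcs : ∀ {g : EuclideanSpace ℝ (Fin d) → ℝ}, tsupport g ⊆ tsupport χ →
      HasCompactSupport g := fun hg => hχc.of_isClosed_subset (isClosed_tsupport _) hg
  have hD := hφ.partialDeriv j
  have hDχ := hχ.partialDeriv j
  -- Even when `φ` has no compact support, `χ φ` is an admissible test function.
  have key := hw (fun x => χ x * φ x) (hχ.mul hφ) (hcs (hsub φ)) ((hsub φ).trans hχs)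
  have hder : ∀ x, fderiv ℝ (fun x => χ x * φ x) x (EuclideanSpace.single j 1) =
      χ x * partialDeriv j φ x + partialDeriv j χ x * φ x := by
    intro x
    rw [fderiv_fun_mul (hχ.differentiable (by simp) x) (hφ.differentiable (by simp) x)]
    simp [mul_comm]
  have i1 := LocallyIntegrableOn.integrable_mul_of_tsupport_subset hu
    (ψ := fun x => χ x * partialDeriv j φ x) (hχ.continuous.mul hD.continuous) (hcs (hsub _)) ((hsub _).trans hχs)
  have i2 := LocallyIntegrableOn.integrable_mul_of_tsupport_subset hu
    (ψ := fun x => partialDeriv j χ x * φ x) (hDχ.continuous.mul hφ.continuous) (hcs (hsub' _)) ((hsub' _).trans hχs)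
  have i3 := LocallyIntegrableOn.integrable_mul_of_tsupport_subset hv
    (ψ := fun x => χ x * φ x) (hχ.continuous.mul hφ.continuous) (hcs (hsub _)) ((hsub _).trans hχs)
  simp only [hder, mul_add] at key
  rw [integral_add i1.integrableOn i2.integrableOn,
    setIntegral_mul_eq_integral_of_tsupport_subset u ((hsub _).trans hχs),
    setIntegral_mul_eq_integral_of_tsupport_subset u ((hsub' _).trans hχs),
    setIntegral_mul_eq_integral_of_tsupport_subset v ((hsub _).trans hχs)] at key
  have e1 : ∫ x, (v x * χ x + u x * partialDeriv j χ x) * φ x =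
      (∫ x, v x * (χ x * φ x)) + ∫ x, u x * (partialDeriv j χ x * φ x) := by
    rw [← integral_add i3 i2]
    congr 1 with x
    ring
  have e2 : ∫ x, (u x * χ x) * partialDeriv j φ x =
      ∫ x, u x * (χ x * partialDeriv j φ x) := by
    congr 1 with x
    ring
  rw [e1, e2]
  linarith

/-- The Fourier integral of a real function in terms of cosine and sine integrals. -/
theorem fourier_ofReal_eq {V : Type*} [NormedAddCommGroup V] [InnerProductSpace ℝ V]
    [FiniteDimensional ℝ V] [MeasurableSpace V] [BorelSpace V] {k : V → ℝ} (hk : Integrable k)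
    (ξ : V) :
    𝓕 (fun x => (k x : ℂ)) ξ = ((∫ x, k x * Real.cos (2 * Real.pi * inner ℝ x ξ) : ℝ) : ℂ)
      - ((∫ x, k x * Real.sin (2 * Real.pi * inner ℝ x ξ) : ℝ) : ℂ) * Complex.I := by
  have hb : ∀ s : ℝ → ℝ, Continuous s → (∀ t, |s t| ≤ 1) →
      Integrable (fun x => k x * s (2 * Real.pi * inner ℝ x ξ)) := by
    intro s hs hs1
    refine hk.mul_bdd (c := 1) (by fun_prop) (Eventually.of_forall fun x => ?_)
    simpa using hs1 _
  have h1 := hb Real.cos Real.continuous_cos Real.abs_cos_le_one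
  have h2 := hb Real.sin Real.continuous_sin Real.abs_sin_le_one
  rw [Real.fourier_eq', ← integral_complex_ofReal, ← integral_complex_ofReal,
    ← integral_mul_const, ← integral_sub h1.ofReal (h2.ofReal.mul_const _)]
  congr 1 with x
  rw [smul_eq_mul, Complex.exp_mul_I, ← Complex.ofReal_cos, ← Complex.ofReal_sin]
  rw [show -2 * Real.pi * inner ℝ x ξ = -(2 * Real.pi * inner ℝ x ξ) by ring, Real.cos_neg,
    Real.sin_neg]
  push_cast
  ring

/-- The Fourier transform turns the weak derivative of a cutoff function into multiplication by
`2πiξⱼ`. -/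
theorem IsWeakPartialDeriv.fourier_cutoff {Ω : Set (EuclideanSpace ℝ (Fin d))} {j : Fin d}
    {u v χ : EuclideanSpace ℝ (Fin d) → ℝ} (h : IsWeakPartialDeriv Ω j u v)
    (hχ : ContDiff ℝ ∞ χ) (hχc : HasCompactSupport χ) (hχs : tsupport χ ⊆ Ω)
    (ξ : EuclideanSpace ℝ (Fin d)) :
    𝓕 (fun x => ((v x * χ x + u x * partialDeriv j χ x : ℝ) : ℂ)) ξ =
      2 * Real.pi * Complex.I * ξ j * 𝓕 (fun x => ((u x * χ x : ℝ) : ℂ)) ξ := by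
  have hsD := tsupport_partialDeriv_subset j χ
  have i1 := LocallyIntegrableOn.integrable_mul_of_tsupport_subset h.1 hχ.continuous hχc hχs
  have i2 := LocallyIntegrableOn.integrable_mul_of_tsupport_subset h.2.1 hχ.continuous hχc hχs
  have i3 := LocallyIntegrableOn.integrable_mul_of_tsupport_subset h.1
    (hχ.partialDeriv j).continuous (hχc.of_isClosed_subset (isClosed_tsupport _) hsD)
    (hsD.trans hχs)
  rw [fourier_ofReal_eq i1, fourier_ofReal_eq
    (k := fun x => v x * χ x + u x * partialDeriv j χ x) (i2.add i3)]
  have hin : ∀ x : EuclideanSpace ℝ (Fin d), HasFDerivAt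
      (fun x : EuclideanSpace ℝ (Fin d) => 2 * Real.pi * inner ℝ x ξ)
      ((2 * Real.pi) • innerSL ℝ ξ) x := by
    intro x
    have := ((innerSL ℝ ξ).hasFDerivAt (x := x)).const_mul (2 * Real.pi)
    refine this.congr_of_eventuallyEq (Eventually.of_forall fun y => ?_)
    simp [real_inner_comm]
  have hξ : inner ℝ ξ (EuclideanSpace.single j (1 : ℝ)) = ξ j := by
    simp [EuclideanSpace.inner_single_right]
  have hcos : ∀ x, partialDeriv j
      (fun x : EuclideanSpace ℝ (Fin d) => Real.cos (2 * Real.pi * inner ℝ x ξ)) x =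
      -(2 * Real.pi * ξ j) * Real.sin (2 * Real.pi * inner ℝ x ξ) := by
    intro x
    rw [partialDeriv, ((hin x).cos).fderiv]
    simp [hξ]
    ring
  have hsin : ∀ x, partialDeriv j
      (fun x : EuclideanSpace ℝ (Fin d) => Real.sin (2 * Real.pi * inner ℝ x ξ)) x =
      (2 * Real.pi * ξ j) * Real.cos (2 * Real.pi * inner ℝ x ξ) := by
    intro x
    rw [partialDeriv, ((hin x).sin).fderiv]
    simp [hξ]
    ring
  have hsm : ContDiff ℝ ∞ (fun x : EuclideanSpace ℝ (Fin d) => 2 * Real.pi * inner ℝ x ξ) :=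
    contDiff_const.mul (contDiff_id.inner ℝ contDiff_const)
  -- Cosine and sine are the real and imaginary parts of the Fourier character, up to sign. They are
  -- not compactly supported, which is why the product rule allows such `φ`.
  have kc := h.integral_cutoff hχ hχc hχs (Real.contDiff_cos.comp hsm)
  have ks := h.integral_cutoff hχ hχc hχs (Real.contDiff_sin.comp hsm)
  simp only [Function.comp_def, hcos, hsin] at kc ks
  have e : ∀ (a : ℝ) (s : EuclideanSpace ℝ (Fin d) → ℝ),
      ∫ x, u x * χ x * (a * s x) = a * ∫ x, u x * χ x * s x := by
    intro a s
    rw [← integral_const_mul]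
    congr 1 with x
    ring
  rw [e] at kc ks
  have kc' := neg_eq_iff_eq_neg.2 kc
  have ks' := neg_eq_iff_eq_neg.2 ks
  rw [← kc', ← ks']
  push_cast
  linear_combination (2 * Real.pi * ξ j *
    ((∫ x, u x * χ x * Real.sin (2 * Real.pi * inner ℝ x ξ) : ℝ) : ℂ)) * Complex.I_sq

/-- Splitting of the `L²` norm of `g` into low frequencies of `g` and its derivatives `hⱼ`. -/
theorem lintegral_sq_le_low_frequency_add {g : EuclideanSpace ℝ (Fin d) → ℂ}
    {h : Fin d → EuclideanSpace ℝ (Fin d) → ℂ} (hg : Integrable g) (hg2 : MemLp g 2)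
    (hh : ∀ j, Integrable (h j)) (hh2 : ∀ j, MemLp (h j) 2)
    (hF : ∀ j ξ, 𝓕 (h j) ξ = 2 * Real.pi * Complex.I * ξ j * 𝓕 g ξ) {R : ℝ} (hR : 0 < R) :
    eLpNorm g 2 volume ^ 2 ≤ (∫⁻ ξ in Metric.ball 0 R, ‖𝓕 g ξ‖ₑ ^ 2) +
      ENNReal.ofReal (1 / R ^ 2) * ∑ j, eLpNorm (h j) 2 volume ^ 2 := by
  have hcont : ∀ {k : EuclideanSpace ℝ (Fin d) → ℂ}, Integrable k → Continuous (𝓕 k) := fun hk =>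
    VectorFourier.fourierIntegral_continuous Real.continuous_fourierChar
      (by exact continuous_inner) hk
  rw [← eLpNorm_fourier_eq hg hg2]
  simp only [← eLpNorm_fourier_eq (hh _) (hh2 _)]
  simp only [eLpNorm_two_sq_eq_lintegral]
  rw [← lintegral_finsetSum _ fun j _ => (hcont (hh j)).measurable.enorm.pow_const 2,
    ← lintegral_const_mul _
      (Finset.measurable_sum _ fun j _ => (hcont (hh j)).measurable.enorm.pow_const 2),
    ← lintegral_add_compl _ (Metric.isOpen_ball (x := (0 : EuclideanSpace ℝ (Fin d)))
      (ε := R)).measurableSet]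
  refine add_le_add_right ?_ _
  refine le_trans (setLIntegral_mono' Metric.isOpen_ball.measurableSet.compl fun ξ hξ => ?_)
    (setLIntegral_le_lintegral _ _)
  have hξR : R ≤ ‖ξ‖ := by simpa using hξ
  have hen : ∀ z : ℂ, ‖z‖ₑ ^ 2 = ENNReal.ofReal (‖z‖ ^ 2) := fun z => by
    rw [← ofReal_norm, ENNReal.ofReal_pow (norm_nonneg _)]
  simp only [hen]
  rw [← ENNReal.ofReal_sum_of_nonneg fun j _ => by positivity,
    ← ENNReal.ofReal_mul (by positivity)]
  refine ENNReal.ofReal_le_ofReal ?_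
  -- Summing `|2πξⱼ|²` over `j` gives `(2π)²‖ξ‖²`, which is at least `R ^ 2` off the ball; the
  -- factor `(2π)² ≥ 1` is discarded.
  have hsum : ∑ j, ‖𝓕 (h j) ξ‖ ^ 2 = (2 * Real.pi) ^ 2 * ‖ξ‖ ^ 2 * ‖𝓕 g ξ‖ ^ 2 := by
    rw [EuclideanSpace.real_norm_sq_eq, Finset.mul_sum, Finset.sum_mul]
    refine Finset.sum_congr rfl fun j _ => ?_
    rw [hF]
    simp only [norm_mul, Complex.norm_I, Complex.norm_real, Real.norm_eq_abs, mul_pow, sq_abs]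
    norm_num
  rw [hsum, one_div, inv_mul_eq_div, le_div_iff₀ (by positivity)]
  have h1 : R ^ 2 ≤ ‖ξ‖ ^ 2 := by gcongr
  have h2 : (1 : ℝ) ≤ (2 * Real.pi) ^ 2 := by nlinarith [Real.pi_gt_three]
  nlinarith [sq_nonneg ‖𝓕 g ξ‖, mul_le_mul h2 h1 (by positivity) (by positivity)]

end Rellich

/-! ### Local Rellich compactness -/

section LocalCompactness

open Filter Topology FourierTransform

variable {d : ℕ}

/-- A compact subset of an open set admits a smooth compactly supported cutoff. -/
theorem exists_contDiff_cutoff {Ω K : Set (EuclideanSpace ℝ (Fin d))} (hΩ : IsOpen Ω)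
    (hK : IsCompact K) (hKΩ : K ⊆ Ω) :
    ∃ χ : EuclideanSpace ℝ (Fin d) → ℝ, ContDiff ℝ ∞ χ ∧ HasCompactSupport χ ∧
      tsupport χ ⊆ Ω ∧ ∀ x ∈ K, χ x = 1 := by
  obtain ⟨L, hL, hKL, hLΩ⟩ := exists_compact_between hK hΩ hKΩ
  obtain ⟨χ, h1, h0, -⟩ := exists_contMDiffMap_one_nhds_of_subset_interior (n := ⊤)
    (modelWithCornersSelf ℝ (EuclideanSpace ℝ (Fin d))) hK.isClosed hKL
  have hs : tsupport χ ⊆ L := closure_minimal (fun x hx => by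
    by_contra h
    exact hx (h0 x h)) hL.isClosed
  exact ⟨χ, χ.contMDiff.contDiff, hL.of_isClosed_subset (isClosed_tsupport _) hs, hs.trans hLΩ,
    fun x hx => h1.self_of_nhdsSet x hx⟩

/-- Multiplication by a continuous function with compact support in `Ω` maps `L²(Ω)` to
`L²(ℝᵈ)`. -/
theorem exists_eLpNorm_mul_le {X : Type*} [TopologicalSpace X] [MeasurableSpace X]
    (ρ : Measure X) {Ω : Set X} {ψ : X → ℝ} (hψ : Continuous ψ)
    (hc : HasCompactSupport ψ) (hs : tsupport ψ ⊆ Ω) :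
    ∃ A : ℝ, ∀ u : X → ℝ,
      eLpNorm (fun x => u x * ψ x) 2 ρ ≤ ENNReal.ofReal A * eLpNorm u 2 (ρ.restrict Ω) := by
  obtain ⟨A, hA⟩ := hc.exists_bound_of_continuous hψ
  refine ⟨A, fun u => ?_⟩
  rw [← eLpNorm_restrict_eq_of_support_subset (s := Ω)
    (fun x hx => hs (subset_tsupport _ (right_ne_zero_of_mul hx)))]
  refine eLpNorm_le_mul_eLpNorm_of_ae_le_mul (Eventually.of_forall fun x => ?_) 2
  rw [norm_mul, mul_comm]
  exact mul_le_mul_of_nonneg_right (hA x) (norm_nonneg _)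

theorem eLpNorm_complex_ofReal {X : Type*} [MeasurableSpace X] (ρ : Measure X) (k : X → ℝ)
    (p : ℝ≥0∞) : eLpNorm (fun x => (k x : ℂ)) p ρ = eLpNorm k p ρ :=
  eLpNorm_congr_norm_ae (Eventually.of_forall fun x => by simp)

/-- Local Rellich compactness: a sequence that is bounded in `H¹(Ω)` and converges to zero in the
sense of distributions converges to zero in `L²` after multiplication with a cutoff. -/
theorem tendsto_eLpNorm_cutoff {Ω : Set (EuclideanSpace ℝ (Fin d))}
    {w : ℕ → EuclideanSpace ℝ (Fin d) → ℝ} {v : ℕ → Fin d → EuclideanSpace ℝ (Fin d) → ℝ}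
    (hloc : ∀ n, LocallyIntegrableOn (w n) Ω)
    (hwv : ∀ n j, IsWeakPartialDeriv Ω j (w n) (v n j)) {M : ℝ≥0∞} (hM : M ≠ ⊤)
    (hw : ∀ n, eLpNorm (w n) 2 (volume.restrict Ω) ≤ M)
    (hv : ∀ n j, eLpNorm (v n j) 2 (volume.restrict Ω) ≤ M)
    (hweak : ∀ φ : EuclideanSpace ℝ (Fin d) → ℝ, ContDiff ℝ ∞ φ → HasCompactSupport φ →
      tsupport φ ⊆ Ω → Tendsto (fun n => ∫ x in Ω, w n x * φ x) atTop (𝓝 0))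
    {χ : EuclideanSpace ℝ (Fin d) → ℝ} (hχ : ContDiff ℝ ∞ χ) (hχc : HasCompactSupport χ)
    (hχs : tsupport χ ⊆ Ω) :
    Tendsto (fun n => eLpNorm (fun x => w n x * χ x) 2 volume) atTop (𝓝 0) := by
  have hD : ∀ j, HasCompactSupport (partialDeriv j χ) := fun j =>
    hχc.of_isClosed_subset (isClosed_tsupport _) (tsupport_partialDeriv_subset j χ)
  have hDs : ∀ j, tsupport (partialDeriv j χ) ⊆ Ω := fun j =>
    (tsupport_partialDeriv_subset j χ).trans hχs
  have hDc : ∀ j, Continuous (partialDeriv j χ) := fun j => (hχ.partialDeriv j).continuous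
  set g : ℕ → EuclideanSpace ℝ (Fin d) → ℂ := fun n x => ((w n x * χ x : ℝ) : ℂ) with hg
  set h : ℕ → Fin d → EuclideanSpace ℝ (Fin d) → ℂ := fun n j x =>
    ((v n j x * χ x + w n x * partialDeriv j χ x : ℝ) : ℂ) with hh
  have ig : ∀ n, Integrable (fun x => w n x * χ x) := fun n =>
    (hloc n).integrable_mul_of_tsupport_subset hχ.continuous hχc hχs
  have iv : ∀ n j, Integrable (fun x => v n j x * χ x) := fun n j =>
    (hwv n j).2.1.integrable_mul_of_tsupport_subset hχ.continuous hχc hχs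
  have iw : ∀ n j, Integrable (fun x => w n x * partialDeriv j χ x) := fun n j =>
    (hloc n).integrable_mul_of_tsupport_subset (hDc j) (hD j) (hDs j)
  obtain ⟨A, hA⟩ := exists_eLpNorm_mul_le volume hχ.continuous hχc hχs
  choose B hB using fun j => exists_eLpNorm_mul_le volume (hDc j) (hD j) (hDs j)
  have ng : ∀ n, eLpNorm (g n) 2 volume ≤ ENNReal.ofReal A * M := fun n => by
    rw [hg, eLpNorm_complex_ofReal]
    exact (hA _).trans (by gcongr; exact hw n)
  have nh : ∀ n j, eLpNorm (h n j) 2 volume ≤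
      ENNReal.ofReal A * M + ENNReal.ofReal (B j) * M := fun n j => by
    rw [hh, eLpNorm_complex_ofReal]
    refine (eLpNorm_add_le (iv n j).1 (iw n j).1 (by norm_num)).trans (add_le_add ?_ ?_)
    · exact (hA _).trans (by gcongr; exact hv n j)
    · exact (hB j _).trans (by gcongr; exact hw n)
  have mg : ∀ n, MemLp (g n) 2 := fun n =>
    ⟨(ig n).ofReal.1, (ng n).trans_lt (ENNReal.mul_lt_top (by simp) hM.lt_top)⟩
  have mh : ∀ n j, MemLp (h n j) 2 := fun n j =>
    ⟨((iv n j).add (iw n j)).ofReal.1, (nh n j).trans_lt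
      (ENNReal.add_lt_top.2 ⟨ENNReal.mul_lt_top (by simp) hM.lt_top,
        ENNReal.mul_lt_top (by simp) hM.lt_top⟩)⟩
  set N : ℝ≥0∞ := ∑ j, (ENNReal.ofReal A * M + ENNReal.ofReal (B j) * M) ^ 2 with hN
  have hNtop : N ≠ ⊤ := by
    refine ENNReal.sum_ne_top.2 fun j _ => ENNReal.pow_ne_top (ENNReal.add_ne_top.2
      ⟨ENNReal.mul_ne_top (by simp) hM, ENNReal.mul_ne_top (by simp) hM⟩)
  -- The tail constant `N` does not depend on `n`, so high frequencies are small uniformly along the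
  -- sequence.
  have split : ∀ (n : ℕ) {R : ℝ}, 0 < R → eLpNorm (g n) 2 volume ^ 2 ≤
      (∫⁻ ξ in Metric.ball 0 R, ‖𝓕 (g n) ξ‖ₑ ^ 2) + ENNReal.ofReal (1 / R ^ 2) * N := by
    intro n R hR
    refine (lintegral_sq_le_low_frequency_add (ig n).ofReal (mg n)
      (fun j => ((iv n j).add (iw n j)).ofReal) (mh n)
      (fun j ξ => (hwv n j).fourier_cutoff hχ hχc hχs ξ) hR).trans ?_
    have hsum : ∑ j, eLpNorm (h n j) 2 volume ^ 2 ≤ N :=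
      Finset.sum_le_sum fun j _ => pow_le_pow_left' (nh n j) 2
    exact add_le_add le_rfl (mul_le_mul' le_rfl hsum)
  -- The transform is bounded by the `L¹` norm, and Cauchy-Schwarz bounds that by `‖w n‖₂ ‖χ‖₂`.
  -- This constant is the dominating function on balls.
  have gbound : ∀ n ξ, ‖𝓕 (g n) ξ‖ₑ ≤ M * eLpNorm χ 2 volume := by
    intro n ξ
    have e1 : ‖𝓕 (g n) ξ‖ₑ ≤ eLpNorm (g n) 1 volume := by
      have := VectorFourier.norm_fourierIntegral_le_integral_norm Real.fourierChar volume
        (innerₗ (EuclideanSpace ℝ (Fin d))) (g n) ξ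
      rw [← ofReal_norm, eLpNorm_one_eq_lintegral_enorm,
        ← ofReal_integral_norm_eq_lintegral_enorm (ig n).ofReal]
      exact ENNReal.ofReal_le_ofReal this
    have e2 : eLpNorm (g n) 1 volume = eLpNorm (fun x => w n x * χ x) 1 (volume.restrict Ω) := by
      rw [eLpNorm_restrict_eq_of_support_subset
        (fun x hx => hχs (subset_tsupport _ (right_ne_zero_of_mul hx))), hg,
        eLpNorm_complex_ofReal]
    rw [e2] at e1
    refine e1.trans ((eLpNorm_smul_le_mul_eLpNorm (p := 2) (q := 2) (f := χ) (φ := w n)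
      hχ.continuous.aestronglyMeasurable (hloc n).aestronglyMeasurable).trans ?_)
    gcongr
    · exact hw n
    · exact Measure.restrict_le_self
  -- At fixed `ξ` the transform integrates `w n` against `χ cos` and `χ sin`, which are test
  -- functions in `Ω`.
  have hpt : ∀ ξ, Tendsto (fun n => 𝓕 (g n) ξ) atTop (𝓝 0) := by
    intro ξ
    have hlim : ∀ s : ℝ → ℝ, ContDiff ℝ ∞ s → Tendsto (fun n =>
        ∫ x, w n x * χ x * s (2 * Real.pi * inner ℝ x ξ)) atTop (𝓝 0) := by
      intro s hs
      have hsm : ContDiff ℝ ∞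
          (fun x : EuclideanSpace ℝ (Fin d) => s (2 * Real.pi * inner ℝ x ξ)) :=
        hs.comp (contDiff_const.mul (contDiff_id.inner ℝ contDiff_const))
      have hsub : tsupport (fun x => χ x * s (2 * Real.pi * inner ℝ x ξ)) ⊆ tsupport χ :=
        tsupport_mul_subset_left
      have := hweak _ (hχ.mul hsm) (hχc.of_isClosed_subset (isClosed_tsupport _) hsub)
        (hsub.trans hχs)
      refine this.congr fun n => ?_
      rw [setIntegral_mul_eq_integral_of_tsupport_subset (w n) (hsub.trans hχs)]
      simp only [mul_assoc]
    simp only [hg, fourier_ofReal_eq (ig _)]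
    have h1 := (Complex.continuous_ofReal.tendsto 0).comp (hlim _ Real.contDiff_cos)
    have h2 := (Complex.continuous_ofReal.tendsto 0).comp (hlim _ Real.contDiff_sin)
    simpa [Function.comp_def] using h1.sub (h2.mul_const Complex.I)
  have hball : ∀ R : ℝ, Tendsto (fun n => ∫⁻ ξ in Metric.ball 0 R, ‖𝓕 (g n) ξ‖ₑ ^ 2)
      atTop (𝓝 0) := by
    intro R
    have := tendsto_lintegral_of_dominated_convergence (F := fun n ξ => ‖𝓕 (g n) ξ‖ₑ ^ 2)
      (f := fun _ => 0) (μ := volume.restrict (Metric.ball (0 : EuclideanSpace ℝ (Fin d)) R))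
      (fun _ => (M * eLpNorm χ 2 volume) ^ 2) (fun n => ?_) (fun n => ?_) ?_ ?_
    · simpa using this
    · exact (VectorFourier.fourierIntegral_continuous Real.continuous_fourierChar
        (by exact continuous_inner) (ig n).ofReal).measurable.enorm.pow_const 2
    · exact Eventually.of_forall fun ξ => pow_le_pow_left' (gbound n ξ) 2
    · rw [lintegral_const]
      refine ENNReal.mul_ne_top (ENNReal.pow_ne_top (ENNReal.mul_ne_top hM
        (hχ.continuous.memLp_of_hasCompactSupport hχc).2.ne)) ?_
      rw [Measure.restrict_apply_univ]
      exact measure_ball_lt_top.ne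
    · refine Eventually.of_forall fun ξ => ?_
      simpa [Function.comp_def] using ((ENNReal.continuous_pow 2).tendsto 0).comp (by simpa using (hpt ξ).enorm)
  -- `R` is fixed first to make the tail at most `ε / 2` for all `n`; then `n` is taken large for
  -- the ball.
  have hsq : Tendsto (fun n => eLpNorm (g n) 2 volume ^ 2) atTop (𝓝 0) := by
    rw [ENNReal.tendsto_nhds_zero]
    intro ε hε
    have hR : Tendsto (fun R : ℝ => ENNReal.ofReal (1 / R ^ 2) * N) atTop (𝓝 0) := by
      have h0 : Tendsto (fun R : ℝ => 1 / R ^ 2) atTop (𝓝 0) := by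
        simpa [Function.comp_def] using tendsto_inv_atTop_zero.comp (tendsto_pow_atTop (α := ℝ) two_ne_zero)
      have := ENNReal.Tendsto.mul_const (ENNReal.tendsto_ofReal h0) (Or.inr hNtop)
      simpa using this
    have hε2 : 0 < ε / 2 := ENNReal.half_pos hε.ne'
    obtain ⟨R, hR1, hR0⟩ := ((ENNReal.tendsto_nhds_zero.1 hR (ε / 2) hε2).and
      (eventually_gt_atTop 0)).exists
    filter_upwards [ENNReal.tendsto_nhds_zero.1 (hball R) (ε / 2) hε2] with n hn
    exact (split n hR0).trans ((add_le_add hn hR1).trans (ENNReal.add_halves ε).le)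
  have hfin : Tendsto (fun n => (eLpNorm (g n) 2 volume ^ 2) ^ (1 / 2 : ℝ)) atTop (𝓝 0) := by
    have := (ENNReal.continuous_rpow_const (y := 1 / 2)).tendsto 0 |>.comp hsq
    simpa [Function.comp_def] using this
  refine hfin.congr fun n => ?_
  rw [hg, eLpNorm_complex_ofReal, ← ENNReal.rpow_natCast, ← ENNReal.rpow_mul]
  norm_num

end LocalCompactness

/-! ### From local convergence to convergence in measure -/

section ConvergenceInMeasure

open Filter Topology

variable {d : ℕ}

/-- Local `L²` convergence of the components on a bounded open set implies convergence in
measure. -/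
theorem tendstoInMeasure_of_tendsto_eLpNorm_cutoff {Ω : Set (EuclideanSpace ℝ (Fin d))}
    (hΩ : IsOpen Ω) (hΩf : volume Ω ≠ ⊤)
    {S : ℕ → EuclideanSpace ℝ (Fin d) → EuclideanSpace ℝ (Fin d)}
    {T : EuclideanSpace ℝ (Fin d) → EuclideanSpace ℝ (Fin d)}
    (hS : ∀ n, AEStronglyMeasurable (S n) (volume.restrict Ω))
    (hT : AEStronglyMeasurable T (volume.restrict Ω))
    (h : ∀ χ : EuclideanSpace ℝ (Fin d) → ℝ, ContDiff ℝ ∞ χ → HasCompactSupport χ →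
      tsupport χ ⊆ Ω → ∀ i,
        Tendsto (fun n => eLpNorm (fun x => (S n x i - T x i) * χ x) 2 volume) atTop (𝓝 0)) :
    TendstoInMeasure (volume.restrict Ω) S atTop T := by
  rw [tendstoInMeasure_iff_norm]
  intro ε hε
  rw [ENNReal.tendsto_nhds_zero]
  intro δ hδ
  have hδ2 : δ / 2 ≠ 0 := (ENNReal.half_pos hδ.ne').ne'
  -- Inner regularity replaces any control near the boundary: `Ω \ K` has measure below `δ / 2`, and
  -- on `K` the cutoff equals `1`.
  obtain ⟨K, hKΩ, hK, hKδ⟩ := hΩ.measurableSet.exists_isCompact_sdiff_lt hΩf hδ2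
  obtain ⟨χ, hχ, hχc, hχs, hχK⟩ := exists_contDiff_cutoff hΩ hK hKΩ
  have hmeas : ∀ n, AEStronglyMeasurable (fun x => χ x • (S n x - T x)) (volume.restrict Ω) :=
    fun n => hχ.continuous.aestronglyMeasurable.smul ((hS n).sub hT)
  have hlim : Tendsto (fun n => eLpNorm (fun x => χ x • (S n x - T x)) 2 (volume.restrict Ω))
      atTop (𝓝 0) := by
    have hsum : Tendsto (fun n => ∑ i, eLpNorm (fun x => (S n x i - T x i) * χ x) 2 volume)
        atTop (𝓝 0) := by
      simpa using tendsto_finsetSum Finset.univ fun i _ => h χ hχ hχc hχs i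
    refine tendsto_of_tendsto_of_tendsto_of_le_of_le tendsto_const_nhds hsum
      (fun _ => zero_le) fun n => ?_
    have hcm : ∀ i, AEStronglyMeasurable (fun x => (S n x i - T x i) * χ x)
        (volume.restrict Ω) := fun i => by
      have := (EuclideanSpace.proj i : EuclideanSpace ℝ (Fin d) →L[ℝ] ℝ).continuous
        |>.comp_aestronglyMeasurable (hmeas n)
      refine this.congr (Eventually.of_forall fun x => ?_)
      simp [mul_comm]
    calc eLpNorm (fun x => χ x • (S n x - T x)) 2 (volume.restrict Ω)
        ≤ eLpNorm (∑ i, fun x => ‖(S n x i - T x i) * χ x‖) 2 (volume.restrict Ω) := by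
          refine eLpNorm_mono_real fun x => ?_
          rw [Finset.sum_apply]
          have hb := (EuclideanSpace.basisFun (Fin d) ℝ).sum_repr (χ x • (S n x - T x))
          rw [← hb]
          refine (norm_sum_le _ _).trans (Finset.sum_le_sum fun i _ => ?_)
          rw [norm_smul, OrthonormalBasis.norm_eq_one, mul_one]
          simp [mul_comm]
      _ ≤ ∑ i, eLpNorm (fun x => ‖(S n x i - T x i) * χ x‖) 2 (volume.restrict Ω) :=
          eLpNorm_sum_le (fun i _ => (hcm i).norm) (by norm_num)
      _ ≤ _ := by
          refine Finset.sum_le_sum fun i _ => ?_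
          rw [eLpNorm_norm]
          exact eLpNorm_mono_measure _ Measure.restrict_le_self
  have hm := tendstoInMeasure_of_tendsto_eLpNorm (g := fun _ => 0) two_ne_zero hmeas
    aestronglyMeasurable_const (by simpa [Pi.sub_def] using hlim)
  rw [tendstoInMeasure_iff_norm] at hm
  filter_upwards [ENNReal.tendsto_nhds_zero.1 (hm ε hε) (δ / 2) (pos_iff_ne_zero.2 hδ2)]
    with n hn
  have hsub : {x | ε ≤ ‖S n x - T x‖} ⊆
      Kᶜ ∪ {x | ε ≤ ‖χ x • (S n x - T x) - 0‖} := by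
    intro x hx
    by_cases hxK : x ∈ K
    · right
      simpa [hχK x hxK] using hx
    · exact Or.inl hxK
  refine (measure_mono hsub).trans ((measure_union_le _ _).trans
    ((add_le_add ?_ hn).trans (ENNReal.add_halves δ).le))
  rw [Measure.restrict_apply hK.measurableSet.compl, inter_comm, ← sdiff_eq]
  exact hKδ.le

end ConvergenceInMeasure

/-! ### The energy as a weighted Hilbert norm -/

section TransportField

open Filter Topology

variable {d : ℕ}

/-- Index type for a displacement vector together with a Jacobian matrix. -/
abbrev FieldIndex (d : ℕ) : Type := Fin d ⊕ Fin d × Fin d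

/-- The displacement `T x - x` and the matrix `G x`, gathered in one Euclidean vector. -/
noncomputable def transportField
    (T : EuclideanSpace ℝ (Fin d) → EuclideanSpace ℝ (Fin d))
    (G : EuclideanSpace ℝ (Fin d) → Matrix (Fin d) (Fin d) ℝ) (x : EuclideanSpace ℝ (Fin d)) :
    EuclideanSpace ℝ (FieldIndex d) :=
  WithLp.toLp 2 (Sum.elim (fun i => T x i - x i) fun p => G x p.1 p.2)

theorem norm_sq_transportField (T : EuclideanSpace ℝ (Fin d) → EuclideanSpace ℝ (Fin d))
    (G : EuclideanSpace ℝ (Fin d) → Matrix (Fin d) (Fin d) ℝ) (x : EuclideanSpace ℝ (Fin d)) :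
    ‖transportField T G x‖ ^ 2 = ‖T x - x‖ ^ 2 + ∑ i, ∑ j, G x i j ^ 2 := by
  rw [EuclideanSpace.real_norm_sq_eq, EuclideanSpace.real_norm_sq_eq, Fintype.sum_sum_type,
    Fintype.sum_prod_type]
  simp [transportField]

/-- Boundedness of `Ω` puts the identity map in `L²(Ω)`, so subtracting it is harmless. -/
theorem memLp_transportField {Ω : Set (EuclideanSpace ℝ (Fin d))} (hΩ : IsOpen Ω)
    (hΩb : Bornology.IsBounded Ω)
    {T : EuclideanSpace ℝ (Fin d) → EuclideanSpace ℝ (Fin d)}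
    {G : EuclideanSpace ℝ (Fin d) → Matrix (Fin d) (Fin d) ℝ}
    (hT : MemLp T 2 (volume.restrict Ω))
    (hG : ∀ i j, MemLp (fun x => G x i j) 2 (volume.restrict Ω)) :
    MemLp (transportField T G) 2 (volume.restrict Ω) := by
  have : IsFiniteMeasure (volume.restrict Ω) := ⟨by simpa using hΩb.measure_lt_top⟩
  have hid : MemLp (fun x : EuclideanSpace ℝ (Fin d) => x) 2 (volume.restrict Ω) := by
    obtain ⟨R, hR⟩ := hΩb.exists_norm_le
    refine MemLp.of_bound continuous_id.aestronglyMeasurable R ?_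
    filter_upwards [ae_restrict_mem hΩ.measurableSet] with x hx using hR x hx
  refine MemLp.of_eval_piLp fun k => ?_
  rcases k with i | p
  · exact memLp_piLp_iff.1 (hT.sub hid) i
  · exact hG p.1 p.2

variable {Ω : Set (EuclideanSpace ℝ (Fin d))} {f : EuclideanSpace ℝ (Fin d) → ℝ} {c C : ℝ}

theorem densityMeasure_le_smul (hcC : ∀ᵐ x ∂(volume.restrict Ω), c < f x ∧ f x < C) :
    densityMeasure Ω f ≤ ENNReal.ofReal C • volume.restrict Ω := by
  rw [densityMeasure, ← withDensity_const]
  refine withDensity_mono ?_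
  filter_upwards [hcC] with x hx using ENNReal.ofReal_le_ofReal hx.2.le

/-- The lower bound on `f` transfers `L²(f dx)` bounds and null sets to Lebesgue measure on `Ω`,
where weak derivatives live. -/
theorem restrict_le_smul_densityMeasure (hc : 0 < c)
    (hcC : ∀ᵐ x ∂(volume.restrict Ω), c < f x ∧ f x < C) :
    volume.restrict Ω ≤ ENNReal.ofReal c⁻¹ • densityMeasure Ω f := by
  rw [densityMeasure, ← withDensity_smul' _ _ ENNReal.ofReal_ne_top]
  nth_rw 1 [← withDensity_one (μ := volume.restrict Ω)]
  refine withDensity_mono ?_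
  filter_upwards [hcC] with x hx
  simp only [Pi.one_apply, Pi.smul_apply, smul_eq_mul]
  rw [← ENNReal.ofReal_mul (by positivity), ENNReal.one_le_ofReal, inv_mul_eq_div, le_div_iff₀ hc]
  linarith [hx.1]

/-- Weak Jacobians are unique almost everywhere, so any `G` may replace the chosen representative;
the weight `f` is absorbed into the measure. -/
theorem transportEnergy_eq_eLpNorm_sq (hΩ : IsOpen Ω) (hf : AEMeasurable f (volume.restrict Ω))
    (hc : 0 < c) (hcC : ∀ᵐ x ∂(volume.restrict Ω), c < f x ∧ f x < C)
    {T : EuclideanSpace ℝ (Fin d) → EuclideanSpace ℝ (Fin d)}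
    {G : EuclideanSpace ℝ (Fin d) → Matrix (Fin d) (Fin d) ℝ} (hG : IsWeakJacobian Ω T G) :
    transportEnergy Ω f T = eLpNorm (transportField T G) 2 (densityMeasure Ω f) ^ 2 := by
  have hw : IsWeakJacobian Ω T (weakJacobian Ω T) := by
    have h : ∃ G, IsWeakJacobian Ω T G := ⟨G, hG⟩
    rw [weakJacobian, dif_pos h]
    exact h.choose_spec
  rw [eLpNorm_two_sq_eq_lintegral, densityMeasure,
    lintegral_withDensity_eq_lintegral_mul_non_measurable₀ _ hf.ennreal_ofReal (by simp),
    transportEnergy]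
  refine lintegral_congr_ae ?_
  filter_upwards [hw.ae_eq hΩ hG, hcC] with x hx hfx
  rw [hx, Pi.mul_apply, ← norm_sq_transportField, ← ofReal_norm,
    ← ENNReal.ofReal_pow (norm_nonneg _), mul_comm, ENNReal.ofReal_mul (hc.trans hfx.1).le]

/-- Pairing a component with an `L²(Ω)` function is a bounded functional on the weighted `L²`
space. -/
theorem exists_inner_eq_setIntegral {ι : Type*} [Fintype ι] [DecidableEq ι]
    (hf : AEMeasurable f (volume.restrict Ω))
    (hc : 0 < c) (hcC : ∀ᵐ x ∂(volume.restrict Ω), c < f x ∧ f x < C) (k : ι)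
    {ψ : EuclideanSpace ℝ (Fin d) → ℝ} (hψ : MemLp ψ 2 (volume.restrict Ω)) :
    ∃ g : Lp (EuclideanSpace ℝ ι) 2 (densityMeasure Ω f),
      ∀ b : Lp (EuclideanSpace ℝ ι) 2 (densityMeasure Ω f),
        inner ℝ b g = ∫ x in Ω, b x k * ψ x := by
  -- Dividing by `f` cancels the density in the weighted inner product, and `f > c` keeps the
  -- quotient in `L²`.
  have hmem : MemLp (fun x => EuclideanSpace.single k (ψ x / f x)) 2 (densityMeasure Ω f) := by
    refine MemLp.of_measure_le_smul ENNReal.ofReal_ne_top (densityMeasure_le_smul hcC) ?_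
    refine MemLp.of_le_mul (c := c⁻¹) hψ ?_ ?_
    · have hm : AEMeasurable (fun x => ψ x / f x) (volume.restrict Ω) :=
        hψ.1.aemeasurable.div hf
      have hs : Continuous fun t : ℝ => (EuclideanSpace.single k t : EuclideanSpace ℝ ι) := by
        refine (continuous_id.smul (continuous_const (y := EuclideanSpace.single k (1 : ℝ)))).congr
          fun t => ?_
        ext l
        by_cases h : l = k <;> simp [h]
      exact hs.comp_aestronglyMeasurable hm.aestronglyMeasurable
    · filter_upwards [hcC] with x hx
      rw [PiLp.norm_single, norm_div, Real.norm_of_nonneg (hc.trans hx.1).le,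
        inv_mul_eq_div]
      exact div_le_div_of_nonneg_left (norm_nonneg _) hc hx.1.le
  refine ⟨hmem.toLp _, fun b => ?_⟩
  have e1 : inner ℝ b (hmem.toLp _) =
      ∫ x, inner ℝ (b x) (EuclideanSpace.single k (ψ x / f x)) ∂(densityMeasure Ω f) := by
    rw [L2.inner_def]
    refine integral_congr_ae ?_
    filter_upwards [hmem.coeFn_toLp] with x hx
    rw [hx]
  refine e1.trans ((integral_withDensity_eq_integral_toReal_smul₀ hf.ennreal_ofReal
    (by simp) _).trans (integral_congr_ae ?_))
  filter_upwards [hcC] with x hx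
  have h0 : 0 < f x := hc.trans hx.1
  rw [ENNReal.toReal_ofReal h0.le, EuclideanSpace.inner_single_right, smul_eq_mul]
  simp
  field_simp

end TransportField

/-! ### Stability of weak derivatives -/

section WeakDerivatives

open Filter Topology

variable {d : ℕ} {Ω : Set (EuclideanSpace ℝ (Fin d))}

theorem locallyIntegrableOn_of_memLp_two (hΩ : volume Ω ≠ ⊤) {u : EuclideanSpace ℝ (Fin d) → ℝ}
    (hu : MemLp u 2 (volume.restrict Ω)) : LocallyIntegrableOn u Ω := by
  have : IsFiniteMeasure (volume.restrict Ω) := ⟨by simpa using hΩ.lt_top⟩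
  exact IntegrableOn.locallyIntegrableOn (hu.integrable (by norm_num))

theorem IsWeakPartialDeriv.sub {j : Fin d} {u v u' v' : EuclideanSpace ℝ (Fin d) → ℝ}
    (h : IsWeakPartialDeriv Ω j u v) (h' : IsWeakPartialDeriv Ω j u' v') :
    IsWeakPartialDeriv Ω j (fun x => u x - u' x) (fun x => v x - v' x) := by
  refine ⟨h.1.sub h'.1, h.2.1.sub h'.2.1, fun φ hφ hφc hφs => ?_⟩
  have hsD := tsupport_partialDeriv_subset j φ
  have hDc := hφc.of_isClosed_subset (isClosed_tsupport _) hsD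
  have hD := (hφ.partialDeriv j).continuous
  simp only [sub_mul]
  rw [integral_sub (h.1.integrable_mul_of_tsupport_subset hD hDc (hsD.trans hφs)).integrableOn
      (h'.1.integrable_mul_of_tsupport_subset hD hDc (hsD.trans hφs)).integrableOn,
    integral_sub
      (h.2.1.integrable_mul_of_tsupport_subset hφ.continuous hφc hφs).integrableOn
      (h'.2.1.integrable_mul_of_tsupport_subset hφ.continuous hφc hφs).integrableOn,
    h.2.2 φ hφ hφc hφs, h'.2.2 φ hφ hφc hφs]
  ring

/-- Weak derivatives pass to the limit in the sense of distributions. -/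
theorem IsWeakPartialDeriv.of_tendsto {j : Fin d} {u v : ℕ → EuclideanSpace ℝ (Fin d) → ℝ}
    {u' v' : EuclideanSpace ℝ (Fin d) → ℝ} (h : ∀ n, IsWeakPartialDeriv Ω j (u n) (v n))
    (hu' : LocallyIntegrableOn u' Ω) (hv' : LocallyIntegrableOn v' Ω)
    (hu : ∀ φ : EuclideanSpace ℝ (Fin d) → ℝ, ContDiff ℝ ∞ φ → HasCompactSupport φ →
      tsupport φ ⊆ Ω →
      Tendsto (fun n => ∫ x in Ω, u n x * φ x) atTop (𝓝 (∫ x in Ω, u' x * φ x)))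
    (hv : ∀ φ : EuclideanSpace ℝ (Fin d) → ℝ, ContDiff ℝ ∞ φ → HasCompactSupport φ →
      tsupport φ ⊆ Ω →
      Tendsto (fun n => ∫ x in Ω, v n x * φ x) atTop (𝓝 (∫ x in Ω, v' x * φ x))) :
    IsWeakPartialDeriv Ω j u' v' := by
  refine ⟨hu', hv', fun φ hφ hφc hφs => ?_⟩
  have hsD := tsupport_partialDeriv_subset j φ
  -- `∂ⱼφ` is itself a test function, so both sides of the defining identity converge.
  refine tendsto_nhds_unique (hu _ (hφ.partialDeriv j)
    (hφc.of_isClosed_subset (isClosed_tsupport _) hsD) (hsD.trans hφs)) ?_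
  exact (hv φ hφ hφc hφs).neg.congr fun n => ((h n).2.2 φ hφ hφc hφs).symm

end WeakDerivatives

/-! ### Passing to the limit in the fields and the image measure -/

section Existence

open Filter Topology

variable {d : ℕ} {Ω : Set (EuclideanSpace ℝ (Fin d))} {f : EuclideanSpace ℝ (Fin d) → ℝ}
  {c C : ℝ}

/-- Weak convergence of the transport fields in the weighted `L²` space implies convergence of the
maps in measure, and the limit field is again a transport field of a Sobolev map. -/
theorem exists_weak_limit_transportField (hΩ : IsOpen Ω) (hΩb : Bornology.IsBounded Ω)
    (hf : AEMeasurable f (volume.restrict Ω)) (hc : 0 < c)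
    (hcC : ∀ᵐ x ∂(volume.restrict Ω), c < f x ∧ f x < C)
    {S : ℕ → EuclideanSpace ℝ (Fin d) → EuclideanSpace ℝ (Fin d)}
    {J : ℕ → EuclideanSpace ℝ (Fin d) → Matrix (Fin d) (Fin d) ℝ}
    (hS : ∀ n, MemLp (S n) 2 (volume.restrict Ω))
    (hJ : ∀ n, IsWeakJacobian Ω (S n) (J n))
    {F : ℕ → Lp (EuclideanSpace ℝ (FieldIndex d)) 2 (densityMeasure Ω f)}
    (hF : ∀ n, F n =ᵐ[densityMeasure Ω f] transportField (S n) (J n))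
    {M : ℝ} (hM : ∀ n, ‖F n‖ ≤ M)
    {a : Lp (EuclideanSpace ℝ (FieldIndex d)) 2 (densityMeasure Ω f)}
    (ha : ∀ y, Tendsto (fun n => inner ℝ (F n) y) atTop (𝓝 (inner ℝ a y))) :
    ∃ T G, MemLp T 2 (volume.restrict Ω) ∧ IsWeakJacobian Ω T G ∧
      (∀ i j, MemLp (fun x => G x i j) 2 (volume.restrict Ω)) ∧ transportField T G = a ∧
      TendstoInMeasure (volume.restrict Ω) S atTop T := by
  have hΩf : volume Ω ≠ ⊤ := hΩb.measure_lt_top.ne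
  have hfin : IsFiniteMeasure (volume.restrict Ω) := ⟨by simpa using hΩf.lt_top⟩
  have hle := restrict_le_smul_densityMeasure hc hcC
  have hac : volume.restrict Ω ≪ densityMeasure Ω f :=
    Measure.absolutelyContinuous_of_le_smul hle
  have hFv : ∀ n, F n =ᵐ[volume.restrict Ω] transportField (S n) (J n) :=
    fun n => hac.ae_le (hF n)
  have hmem : ∀ b : Lp (EuclideanSpace ℝ (FieldIndex d)) 2 (densityMeasure Ω f),
      MemLp b 2 (volume.restrict Ω) := fun b =>
    (Lp.memLp b).of_measure_le_smul ENNReal.ofReal_ne_top hle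
  have hid : MemLp (fun x : EuclideanSpace ℝ (Fin d) => x) 2 (volume.restrict Ω) := by
    obtain ⟨R, hR⟩ := hΩb.exists_norm_le
    refine MemLp.of_bound continuous_id.aestronglyMeasurable R ?_
    filter_upwards [ae_restrict_mem hΩ.measurableSet] with x hx using hR x hx
  -- The limit map and Jacobian are read off from the components of `a`, so `transportField T G = a`
  -- holds at every point; that `G` is the weak Jacobian of `T` is shown afterwards.
  set T : EuclideanSpace ℝ (Fin d) → EuclideanSpace ℝ (Fin d) :=
    fun x => WithLp.toLp 2 fun i => a x (Sum.inl i) + x i with hTdef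
  set G : EuclideanSpace ℝ (Fin d) → Matrix (Fin d) (Fin d) ℝ :=
    fun x i j => a x (Sum.inr (i, j)) with hGdef
  have hcomp : ∀ (b : Lp (EuclideanSpace ℝ (FieldIndex d)) 2 (densityMeasure Ω f)) k,
      MemLp (fun x => b x k) 2 (volume.restrict Ω) := fun b k => memLp_piLp_iff.1 (hmem b) k
  have hT : MemLp T 2 (volume.restrict Ω) := MemLp.of_eval_piLp fun i =>
    (hcomp a (Sum.inl i)).add (memLp_piLp_iff.1 hid i)
  have hG : ∀ i j, MemLp (fun x => G x i j) 2 (volume.restrict Ω) := fun i j =>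
    hcomp a (Sum.inr (i, j))
  have hTG : transportField T G = a := by
    funext x
    ext k
    rcases k with i | p <;> simp [transportField, hTdef, hGdef]
  have hTi : ∀ i, MemLp (fun x => T x i) 2 (volume.restrict Ω) := memLp_piLp_iff.1 hT
  have hSi : ∀ n i, MemLp (fun x => S n x i) 2 (volume.restrict Ω) :=
    fun n => memLp_piLp_iff.1 (hS n)
  have hSTi : ∀ n i, MemLp (fun x => S n x i - T x i) 2 (volume.restrict Ω) :=
    fun n i => (hSi n i).sub (hTi i)
  have hint : ∀ {u ψ : EuclideanSpace ℝ (Fin d) → ℝ}, MemLp u 2 (volume.restrict Ω) →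
      MemLp ψ 2 (volume.restrict Ω) → IntegrableOn (fun x => u x * ψ x) Ω :=
    fun hu hψ => hu.integrable_mul hψ
  have hSx : ∀ n i, (fun x => S n x i) =ᵐ[volume.restrict Ω]
      fun x => F n x (Sum.inl i) + x i := fun n i => by
    filter_upwards [hFv n] with x hx
    simp [hx, transportField]
  have hJx : ∀ n i j, (fun x => J n x i j) =ᵐ[volume.restrict Ω]
      fun x => F n x (Sum.inr (i, j)) := fun n i j => by
    filter_upwards [hFv n] with x hx
    simp [hx, transportField]
  have hweak : ∀ k (φ : EuclideanSpace ℝ (Fin d) → ℝ), MemLp φ 2 (volume.restrict Ω) →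
      Tendsto (fun n => ∫ x in Ω, F n x k * φ x) atTop (𝓝 (∫ x in Ω, a x k * φ x)) := by
    intro k φ hφ
    obtain ⟨g, hg⟩ := exists_inner_eq_setIntegral hf hc hcC k hφ
    simpa only [hg] using ha g
  have htest : ∀ φ : EuclideanSpace ℝ (Fin d) → ℝ, ContDiff ℝ ∞ φ → HasCompactSupport φ →
      MemLp φ 2 (volume.restrict Ω) := fun φ hφ hφc =>
    hφ.continuous.memLp_of_hasCompactSupport hφc
  have hweakJ : ∀ i j (φ : EuclideanSpace ℝ (Fin d) → ℝ), ContDiff ℝ ∞ φ →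
      HasCompactSupport φ →
      Tendsto (fun n => ∫ x in Ω, J n x i j * φ x) atTop (𝓝 (∫ x in Ω, G x i j * φ x)) := by
    intro i j φ hφ hφc
    refine (hweak (Sum.inr (i, j)) φ (htest φ hφ hφc)).congr fun n => integral_congr_ae ?_
    filter_upwards [hJx n i j] with x hx
    rw [hx]
  have hweakD : ∀ i (φ : EuclideanSpace ℝ (Fin d) → ℝ), ContDiff ℝ ∞ φ →
      HasCompactSupport φ →
      Tendsto (fun n => ∫ x in Ω, (S n x i - T x i) * φ x) atTop (𝓝 0) := by
    intro i φ hφ hφc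
    have h1 := (hweak (Sum.inl i) φ (htest φ hφ hφc)).sub_const
      (∫ x in Ω, a x (Sum.inl i) * φ x)
    rw [sub_self] at h1
    refine h1.congr fun n => ?_
    rw [← integral_sub (hint (hcomp (F n) _) (htest φ hφ hφc))
      (hint (hcomp a _) (htest φ hφ hφc))]
    refine integral_congr_ae ?_
    filter_upwards [hSx n i] with x hx
    simp only [hx, hTdef]
    ring
  have hweakS : ∀ i (φ : EuclideanSpace ℝ (Fin d) → ℝ), ContDiff ℝ ∞ φ →
      HasCompactSupport φ →
      Tendsto (fun n => ∫ x in Ω, S n x i * φ x) atTop (𝓝 (∫ x in Ω, T x i * φ x)) := by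
    intro i φ hφ hφc
    have h1 := (hweakD i φ hφ hφc).add_const (∫ x in Ω, T x i * φ x)
    rw [zero_add] at h1
    refine h1.congr fun n => ?_
    rw [← integral_add (hint (hSTi n i) (htest φ hφ hφc)) (hint (hTi i) (htest φ hφ hφc))]
    refine integral_congr_ae (Eventually.of_forall fun x => ?_)
    simp only
    ring
  have hJac : IsWeakJacobian Ω T G := fun i j =>
    IsWeakPartialDeriv.of_tendsto (fun n => hJ n i j)
      (locallyIntegrableOn_of_memLp_two hΩf (hTi i))
      (locallyIntegrableOn_of_memLp_two hΩf (hG i j))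
      (fun φ hφ hφc _ => hweakS i φ hφ hφc) (fun φ hφ hφc _ => hweakJ i j φ hφ hφc)
  refine ⟨T, G, hT, hJac, hG, hTG, ?_⟩
  -- The factor `c^(-1/2)` is the cost of passing from the weighted norm to the Lebesgue one; `M +
  -- ‖a‖` bounds `‖F n - a‖`.
  set B : ℝ≥0∞ := ENNReal.ofReal c⁻¹ ^ (1 / 2 : ℝ≥0∞).toReal * ENNReal.ofReal (M + ‖a‖) with hB
  have hBtop : B ≠ ⊤ := ENNReal.mul_ne_top
    (ENNReal.rpow_ne_top_of_nonneg ENNReal.toReal_nonneg ENNReal.ofReal_ne_top)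
    ENNReal.ofReal_ne_top
  have hbound : ∀ n k, eLpNorm (fun x => F n x k - a x k) 2 (volume.restrict Ω) ≤ B := by
    intro n k
    have e1 : eLpNorm (fun x => F n x k - a x k) 2 (volume.restrict Ω) ≤
        eLpNorm (fun x => F n x - a x) 2 (volume.restrict Ω) :=
      eLpNorm_mono fun x => PiLp.norm_apply_le (F n x - a x) k
    have e2 := eLpNorm_mono_measure (p := 2) (fun x => F n x - a x) hle
    rw [eLpNorm_smul_measure_of_ne_top (by norm_num), smul_eq_mul] at e2
    have e3 : eLpNorm (fun x => F n x - a x) 2 (densityMeasure Ω f) ≤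
        ENNReal.ofReal (M + ‖a‖) := by
      refine (eLpNorm_congr_ae (Lp.coeFn_sub (F n) a).symm).trans_le ?_
      rw [← Lp.enorm_def, ← ofReal_norm]
      exact ENNReal.ofReal_le_ofReal ((norm_sub_le _ _).trans (by linarith [hM n]))
    exact e1.trans (e2.trans (mul_le_mul' le_rfl e3))
  refine tendstoInMeasure_of_tendsto_eLpNorm_cutoff hΩ hΩf (fun n => (hS n).1) hT.1
    fun χ hχ hχc hχs i => ?_
  -- Rellich is applied to `S n - T`, which tends to zero in the sense of distributions and has weak
  -- derivatives `J n - G`.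
  refine tendsto_eLpNorm_cutoff (M := B) (w := fun n x => S n x i - T x i)
    (v := fun n j x => J n x i j - G x i j)
    (fun n => locallyIntegrableOn_of_memLp_two hΩf (hSTi n i))
    (fun n j => (hJ n i j).sub (hJac i j)) hBtop (fun n => ?_) (fun n j => ?_)
    (fun φ hφ hφc _ => hweakD i φ hφ hφc) hχ hχc hχs
  · refine (eLpNorm_congr_ae ?_).trans_le (hbound n (Sum.inl i))
    filter_upwards [hSx n i] with x hx
    simp only [hx, hTdef]
    ring
  · refine (eLpNorm_congr_ae ?_).trans_le (hbound n (Sum.inr (i, j)))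
    filter_upwards [hJx n i j] with x hx
    simp only [hx, hGdef]

theorem MeasureTheory.TendstoInMeasure.of_measure_le_smul {X Y ι : Type*} [MeasurableSpace X]
    [EDist Y] {μ μ' : Measure X} {S : ι → X → Y} {T : X → Y} {l : Filter ι} {K : ℝ≥0∞}
    (hK : K ≠ ⊤) (hle : μ' ≤ K • μ) (h : TendstoInMeasure μ S l T) :
    TendstoInMeasure μ' S l T := by
  intro ε hε
  have h1 := ENNReal.Tendsto.const_mul (h ε hε) (Or.inr hK)
  rw [mul_zero] at h1
  exact tendsto_of_tendsto_of_tendsto_of_le_of_le tendsto_const_nhds h1 (fun _ => zero_le)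
    fun n => hle _

/-- The image measure passes to limits in measure. -/
theorem map_eq_of_tendstoInMeasure {X Y : Type*} [MeasurableSpace X] [PseudoMetricSpace Y]
    [MeasurableSpace Y] [BorelSpace Y] {μ : Measure X} [IsProbabilityMeasure μ]
    {ν : Measure Y} {S : ℕ → X → Y} {T : X → Y} (hS : ∀ n, AEMeasurable (S n) μ)
    (hν : ∀ n, μ.map (S n) = ν) (h : TendstoInMeasure μ S atTop T) : μ.map T = ν := by
  have h1 := h.tendstoInDistribution hS
  -- All `S n` have the same law, so they also converge in distribution to `S 0`; uniqueness of the
  -- limit law identifies the law of `T`.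
  have h2 : TendstoInDistribution S atTop (S 0) (fun _ => μ) μ :=
    tendstoInDistribution_of_identDistrib 0
      (fun n => ⟨hS 0, hS n, (hν 0).trans (hν n).symm⟩) ⟨hS 0, hS 0, rfl⟩
  exact (tendstoInDistribution_unique S h1 h2).trans (hν 0)

end Existence

/-! ### The direct method -/

theorem proposition3p1 {d : ℕ} (Ω : Set (EuclideanSpace ℝ (Fin d)))
    (hΩ_open : IsOpen Ω) (hΩ_bdd : Bornology.IsBounded Ω)
    (f : EuclideanSpace ℝ (Fin d) → ℝ) (hf : AEMeasurable f (volume.restrict Ω))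
    (c C : ℝ) (hc : 0 < c) (hcC : ∀ᵐ x ∂(volume.restrict Ω), c < f x ∧ f x < C)
    (ν : Measure (EuclideanSpace ℝ (Fin d))) (hν : IsProbabilityMeasure ν)
    (hne : (sobolevTransportMaps Ω f ν).Nonempty) :
    ∃ T ∈ sobolevTransportMaps Ω f ν,
      transportEnergy Ω f T = ⨅ S ∈ sobolevTransportMaps Ω f ν, transportEnergy Ω f S := by
  have hμle := densityMeasure_le_smul hcC
  have hac : densityMeasure Ω f ≪ volume.restrict Ω := withDensity_absolutelyContinuous _ _
  -- Image measures keep total mass, so an admissible map forces `f dx` to have mass one.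
  have hμ : IsProbabilityMeasure (densityMeasure Ω f) := by
    obtain ⟨T, -, hT, hTν⟩ := hne
    rw [← Measure.isProbabilityMeasure_map_iff hT, hTν]
    exact hν
  obtain ⟨e, -, he, hemem⟩ := exists_seq_tendsto_sInf (hne.image (transportEnergy Ω f))
    (OrderBot.bddBelow _)
  rw [sInf_image] at he
  choose S hS hSe using hemem
  choose J hJ hJ2 using fun n => (hS n).1.2
  have hmem : ∀ n, MemLp (transportField (S n) (J n)) 2 (densityMeasure Ω f) := fun n =>
    (memLp_transportField hΩ_open hΩ_bdd (hS n).1.1 (hJ2 n)).of_measure_le_smul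
      ENNReal.ofReal_ne_top hμle
  set F : ℕ → Lp (EuclideanSpace ℝ (FieldIndex d)) 2 (densityMeasure Ω f) :=
    fun n => (hmem n).toLp _ with hFdef
  have hFe : ∀ n, ‖F n‖ₑ ^ 2 = e n := fun n => by
    rw [← hSe n, transportEnergy_eq_eLpNorm_sq hΩ_open hf hc hcC (hJ n), Lp.enorm_def,
      eLpNorm_congr_ae (hmem n).coeFn_toLp]
  set m := ⨅ S ∈ sobolevTransportMaps Ω f ν, transportEnergy Ω f S with hm
  -- Admissible maps have finite energy, being squared norms of `L²` fields.
  have hm_top : m ≠ ⊤ := by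
    have h1 : m ≤ e 0 := by
      rw [← hSe 0]
      exact iInf₂_le (S 0) (hS 0)
    refine ne_top_of_le_ne_top ?_ h1
    rw [← hFe 0]
    exact ENNReal.pow_ne_top enorm_ne_top
  have hnorm : Filter.Tendsto (fun n => ‖F n‖) Filter.atTop (nhds (Real.sqrt m.toReal)) := by
    have h1 := (Real.continuous_sqrt.tendsto _).comp ((ENNReal.tendsto_toReal hm_top).comp he)
    refine h1.congr fun n => ?_
    simp only [Function.comp_apply, ← hFe n, ENNReal.toReal_pow, toReal_enorm]
    exact Real.sqrt_sq (norm_nonneg _)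
  obtain ⟨M, hM⟩ := hnorm.bddAbove_range
  have hM' : ∀ n, ‖F n‖ ≤ M := fun n => hM (mem_range_self n)
  -- This lets instance search find that `Lp` is separable, as weak sequential compactness requires.
  have : Fact ((2 : ℝ≥0∞) ≠ ⊤) := ⟨ENNReal.ofNat_ne_top⟩
  obtain ⟨a, φ, hφ, ha⟩ := exists_subseq_tendsto_inner hM'
  have hanorm : ‖a‖ ≤ Real.sqrt m.toReal :=
    norm_le_of_tendsto_inner ha (hnorm.comp hφ.tendsto_atTop)
  obtain ⟨T, G, hT, hJac, hG, hTG, hlim⟩ := exists_weak_limit_transportField hΩ_open hΩ_bdd hf hc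
    hcC (S := fun n => S (φ n)) (J := fun n => J (φ n)) (F := fun n => F (φ n))
    (fun n => (hS (φ n)).1.1) (fun n => hJ (φ n)) (fun n => (hmem (φ n)).coeFn_toLp)
    (fun n => hM' (φ n)) ha
  have hlim' : TendstoInMeasure (densityMeasure Ω f) (fun n => S (φ n)) Filter.atTop T :=
    hlim.of_measure_le_smul ENNReal.ofReal_ne_top hμle
  have hadm : T ∈ sobolevTransportMaps Ω f ν :=
    ⟨⟨hT, G, hJac, hG⟩, hT.1.aemeasurable.mono_ac hac,
      map_eq_of_tendstoInMeasure (fun n => (hS (φ n)).2.1) (fun n => (hS (φ n)).2.2) hlim'⟩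
  refine ⟨T, hadm, le_antisymm ?_ (iInf₂_le T hadm)⟩
  rw [transportEnergy_eq_eLpNorm_sq hΩ_open hf hc hcC hJac, hTG, ← Lp.enorm_def, ← ofReal_norm,
    ← ENNReal.ofReal_pow (norm_nonneg _), ← ENNReal.ofReal_toReal hm_top]
  refine ENNReal.ofReal_le_ofReal ?_
  calc ‖a‖ ^ 2 ≤ Real.sqrt m.toReal ^ 2 := by gcongr
    _ = m.toReal := Real.sq_sqrt ENNReal.toReal_nonneg
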